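/- Let $d\ge 2$, $n\ge 1$, $m$ and $0\le t\le n$ be integers, and let $N=d^n$. The inverse Banyan plane $\mathrm{BY}^{-1}(n)$ has inputs and outputs labeled by the $d$-ary strings of length $n$ and $n$ stages of $d\times d$ switching elements labeled by the $d$-ary strings of length $n-1$. An input $x_1\cdots x_n$ is connected to the element $x_1\cdots x_{n-1}$ of stage $1$, an output $y_1\cdots y_n$ to the element $y_1\cdots y_{n-1}$ of stage $n$, and for $1\le i\le n-1$ the element $z$ of stage $i$ has an internal link to each element of stage $i+1$ whose label agrees with $z$ except possibly in the $i$-th symbol; so there is exactly one route from each input to each output. The network $\log_d(N,0,m)$ is the stack of $m$ copies (planes) of $\mathrm{BY}^{-1}(n)$ with common inputs and outputs. A multicast request is a pair $(a,B)$ of a free input $a$ and a nonempty set $B$ of free outputs, with no restriction on $|B|$; it is realized by choosing for every $b\in B$ a plane such that in that plane the route from $a$ to $b$ shares no internal link with the route of an existing connection (branches of the same request may share links). Established connections may be terminated at any time. The window algorithm with window size $d^t$ partitions the outputs into $d^{n-t}$ windows, each consisting of the $d^t$ outputs with a common prefix of length $n-t$, and demands that for every new request $(a,B)$ and every window $W$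 the branches to the outputs in $B\cap W$ are all routed in one single plane (different windows may use the same or different planes). The network is wide-sense nonblocking with respect to this algorithm if in every state that can arise from the idle network while all requests are routed according to the algorithm (with any permitted choice of planes), every new request can be realized according to the algorithm without disturbing existing connections. Then $\log_d(N,0,m)$ is wide-sense nonblocking with respect to the window algorithm with window size $d^t$ if \[ m\ \ge\ \begin{cases} d^{\,n-2t-1}+t\,d^{\,n-t-1}(d-1) & \text{when } t\le \lfloor n/2\rfloor-1,\\[2pt] d^{\,n-t-1}\bigl[(d-1)(n-t-1)-1\bigr]+d^{\,t}-d^{\,2t-n-1}(d-1)+1 & \text{when } t\ge \lfloor n/2\rfloor, \end{cases} \] where powers with negative exponents are rational numbers and the inequality is one between real numbers. -/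

import Mathlib

namespace Multilog

/-- `d`-ary strings of length `n`; these label the `d ^ n` inputs and the `d ^ n` outputs.
The symbols `x₁ … xₙ` of a string are `x 0, …, x (n - 1)`. -/
abbrev Str (d n : ℕ) : Type := Fin n → Fin d

/-- The string `x₁ … xₙ₋₁`, i.e. `x` without its last symbol: the label of the `d × d` switching
element to which the input `x` (in the first stage) or the output `x` (in the last stage) of an
inverse Banyan plane is connected. -/
def head {d n : ℕ} (x : Str d n) : Str d (n - 1) := fun k => x (k.castLE (Nat.sub_le n 1))

/-- The internal links of the inverse Banyan plane: the switching element labeled `z` in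
stage `i` (counted from `0`) is linked to the switching element labeled `z'` in stage `i + 1`
iff the labels agree except possibly in the symbol of index `i`. -/
def IsLink {d n : ℕ} (i : ℕ) (z z' : Str d (n - 1)) : Prop :=
  ∀ k : Fin (n - 1), (k : ℕ) ≠ i → z' k = z k

/-- `σ` lists the switching elements (one in each of the `n` stages) on a path of the inverse
Banyan plane from the input `x` to the output `y`. -/
def IsPath {d n : ℕ} (x y : Str d n) (σ : Fin n → Str d (n - 1)) : Prop :=
  (∀ i : Fin n, (i : ℕ) = 0 → σ i = head x) ∧
  (∀ i : Fin n, (i : ℕ) + 1 = n → σ i = head y) ∧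
  (∀ i j : Fin n, (j : ℕ) = i + 1 → IsLink (i : ℕ) (σ i) (σ j))

/-- The route `R(x, y)` in the inverse Banyan plane: its switching element in stage `i`
(counted from `0`) is `y₁ … yᵢ xᵢ₊₁ … xₙ₋₁`. -/
def route {d n : ℕ} (x y : Str d n) (i : Fin n) : Str d (n - 1) :=
  fun k => if (k : ℕ) < i then head y k else head x k

/-- `R(x, y)` is the unique path from the input `x` to the output `y`. -/
theorem isPath_iff_eq_route {d n : ℕ} (hn : 1 ≤ n) (x y : Str d n)
    (σ : Fin n → Str d (n - 1)) : IsPath x y σ ↔ σ = route x y := by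
  constructor
  · rintro ⟨h0, h1, h2⟩
    have lo : ∀ (i : ℕ) (hi : i < n) (k : Fin (n - 1)), i ≤ (k : ℕ) →
        σ ⟨i, hi⟩ k = head x k := by
      intro i
      induction i with
      | zero => intro hi k _; rw [h0 ⟨0, hi⟩ rfl]
      | succ i ih =>
        intro hi k hk
        rw [h2 ⟨i, by omega⟩ ⟨i + 1, hi⟩ rfl k (by simp only; omega)]
        exact ih (by omega) k (by omega)
    have hi' : ∀ (j : ℕ) (i : ℕ) (hi : i < n) (k : Fin (n - 1)), i + j + 1 = n → (k : ℕ) < i →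
        σ ⟨i, hi⟩ k = head y k := by
      intro j
      induction j with
      | zero => intro i hi k e _; rw [h1 ⟨i, hi⟩ e]
      | succ j ih =>
        intro i hi k e hk
        rw [← h2 ⟨i, hi⟩ ⟨i + 1, by omega⟩ rfl k (by simp only; omega)]
        exact ih (i + 1) (by omega) k (by omega) (by omega)
    funext i k
    unfold route
    split_ifs with h
    · exact hi' (n - 1 - i) i i.2 k (by omega) h
    · exact lo i i.2 k (by omega)
  · rintro rfl
    refine ⟨?_, ?_, ?_⟩
    · intro i hi; funext k; simp [route, hi]
    · intro i hi; funext k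
      have : (k : ℕ) < i := by have := k.2; omega
      simp [route, this]
    · intro i j hj k hk
      simp only [route, hj]
      have : (k : ℕ) < (i : ℕ) + 1 ↔ (k : ℕ) < i := by omega
      simp only [this]

/-- The routes `R(x, y)` and `R(u, v)`, placed in the same plane, share an internal link, i.e.
they run through the same switching elements in two consecutive stages. -/
def ShareLink {d n : ℕ} (x y u v : Str d n) : Prop :=
  ∃ i j : Fin n, (j : ℕ) = i + 1 ∧ route x y i = route u v i ∧ route x y j = route u v j

/-- A branch of an established connection in the stack of `m` inverse Banyan planes: the route
from `input` to `output` in the plane number `plane`. -/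
structure Branch (d n m : ℕ) where
  input : Str d n
  output : Str d n
  plane : Fin m

/-- A state of the network: the set of all branches of the established connections. The
(multicast) connection from an input consists of all branches with this input. -/
abbrev State (d n m : ℕ) : Type := Set (Branch d n m)

/-- A multicast request `(a, B)`, without fanout restriction. -/
structure Request (d n : ℕ) where
  input : Str d n
  outputs : Finset (Str d n)
  outputs_nonempty : outputs.Nonempty

/-- The request comes from a free input and asks for free outputs only. -/
def Request.IsFree {d n m : ℕ} (r : Request d n) (S : State d n m) : Prop :=
  ∀ e ∈ S, e.input ≠ r.input ∧ e.output ∉ r.outputs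

/-- The request can be realized in state `S` by routing the branch to each requested output `b`
in the plane `φ b`: no branch shares an internal link with an existing route. (Branches of the
same request start at the same input and are allowed to share links.) -/
def Request.IsRealizedBy {d n m : ℕ} (r : Request d n) (S : State d n m)
    (φ : Str d n → Fin m) : Prop :=
  ∀ b ∈ r.outputs, ∀ e ∈ S, e.plane = φ b → ¬ ShareLink r.input b e.input e.output

/-- The branches created by routing each requested output `b` in the plane `φ b`. -/
def Request.branches {d n m : ℕ} (r : Request d n) (φ : Str d n → Fin m) : Set (Branch d n m) :=
  {e | e.input = r.input ∧ e.output ∈ r.outputs ∧ e.plane = φ e.output}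

/-- A routing algorithm, given as a (possibly nondeterministic) rule saying which assignments of
planes to the outputs of a new request are permitted in a given state. -/
abbrev RoutingAlgorithm (d n m : ℕ) : Type :=
  State d n m → Request d n → (Str d n → Fin m) → Prop

/-- The states that can arise, starting from the idle network, when requests and terminations of
connections arrive in any order and all requests are routed according to the algorithm `alg`. -/
inductive Reachable {d n m : ℕ} (alg : RoutingAlgorithm d n m) : State d n m → Prop
  | idle : Reachable alg ∅
  | setup (S : State d n m) (r : Request d n) (φ : Str d n → Fin m) :
      Reachable alg S → r.IsFree S → alg S r φ → r.IsRealizedBy S φ →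
      Reachable alg (S ∪ r.branches φ)
  | release (S : State d n m) (a : Str d n) :
      Reachable alg S → Reachable alg {e ∈ S | e.input ≠ a}

/-- The network `log_d(d ^ n, 0, m)`, a stack of `m` inverse Banyan planes, is wide-sense
nonblocking for multicast requests with respect to `alg`: as long as all requests are routed
according to `alg`, every new request from a free input to free outputs can be realized, again
according to `alg`, without disturbing existing connections. -/
def IsWideSenseNonblocking {d n m : ℕ} (alg : RoutingAlgorithm d n m) : Prop :=
  ∀ S : State d n m, Reachable alg S → ∀ r : Request d n, r.IsFree S →
    ∃ φ : Str d n → Fin m, alg S r φ ∧ r.IsRealizedBy S φ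

/-- The window (of size `d ^ t`, for `t ≤ n`) of all outputs with prefix `w` of length `n - t`. -/
def window {d n : ℕ} (t : ℕ) (w : Str d (n - t)) : Set (Str d n) :=
  {b | ∀ k : Fin (n - t), b (k.castLE (Nat.sub_le n t)) = w k}

/-- The window algorithm with window size `d ^ t`: for every window, the subrequest to the
requested outputs in this window is routed entirely in one single plane. -/
def windowAlgorithm (d n m t : ℕ) : RoutingAlgorithm d n m := fun _ r φ =>
  ∀ w : Str d (n - t), ∃ p : Fin m, ∀ b ∈ r.outputs, b ∈ window t w → φ b = p

end Multilog

namespace Multilog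

open Finset

/-! Fix a request and one requested output `b`. The window of `b` can be served as soon as the
established branches that share a link with some requested route into that window occupy fewer than
`m` planes (`isWideSenseNonblocking_of_card_lt`). These blockers are sorted by the length `p` of the
common prefix of their output with `b`.

For `1 ≤ p < n - t` there are two bounds. Outputs are never shared, which gives `d^(n-p) -
d^(n-p-1)`. Alternatively, a link is shared no later than the one entering stage `p + 1`, so at most
`d^p - 1` inputs are involved, and each uses a single plane per window. For small `t` the input
bound serves `p ≤ t` and the output bound the rest; for large `t` the input bound is used
throughout.

Blockers inside the window number at most `d^t - 1`. If `2t > n` this improves: many distinct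
`t`-prefixes among the requested outputs leave few free outputs in the window, while few such
prefixes leave few outputs that late links can block. `card_planes_blockersIn_le_of_large` balances
the two. -/

/-! ### Shared links as agreement of prefixes and suffixes -/

/-- The strings `y` and `v` have the same first `j` symbols. -/
def Agree {d n : ℕ} (j : ℕ) (y v : Str d n) : Prop := ∀ k : Fin n, (k : ℕ) < j → y k = v k

/-- The strings `x` and `u` have the same symbols `x j, …, x (n - 1)`, counted from `1`. -/
def TailAgree {d n : ℕ} (j : ℕ) (x u : Str d n) : Prop :=
  ∀ k : Fin n, j ≤ (k : ℕ) + 1 ∧ (k : ℕ) + 1 < n → x k = u k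

/-- The prefix of length `j` of a string. -/
def pref {d n j : ℕ} (h : j ≤ n) (y : Str d n) : Str d j := fun k => y (k.castLE h)

theorem pref_eq_iff {d n j : ℕ} (h : j ≤ n) (y v : Str d n) :
    pref h y = pref h v ↔ Agree j y v :=
  ⟨fun e k hk => congrFun e ⟨k, hk⟩, fun e => funext fun k => e (k.castLE h) k.2⟩

theorem Agree.symm {d n j : ℕ} {y v : Str d n} (h : Agree j y v) : Agree j v y :=
  fun k hk => (h k hk).symm

theorem Agree.trans {d n j : ℕ} {y v w : Str d n} (h : Agree j y v) (h' : Agree j v w) :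
    Agree j y w :=
  fun k hk => (h k hk).trans (h' k hk)

theorem Agree.mono {d n i j : ℕ} {y v : Str d n} (hij : i ≤ j) (h : Agree j y v) : Agree i y v :=
  fun k hk => h k (hk.trans_le hij)

theorem TailAgree.mono {d n i j : ℕ} {x u : Str d n} (hij : i ≤ j) (h : TailAgree i x u) :
    TailAgree j x u :=
  fun k hk => h k ⟨hij.trans hk.1, hk.2⟩

/-- The later element of the link fixes the first `j` output symbols, the earlier one the input
symbols from `j` on. The last input symbol stays free because element labels omit it. -/
theorem ShareLink.exists_agree {d n : ℕ} {x y u v : Str d n} (h : ShareLink x y u v) :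
    ∃ j, 1 ≤ j ∧ j < n ∧ Agree j y v ∧ TailAgree j x u := by
  obtain ⟨i, j, hij, hi, hj⟩ := h
  refine ⟨j, by omega, j.2, fun k hk => ?_, fun k hk => ?_⟩
  · have := congrFun hj ⟨k, by omega⟩
    simpa [route, hk, head] using this
  · have := congrFun hi ⟨k, by omega⟩
    have hki : ¬ (k : ℕ) < i := by omega
    simpa [route, hki, head] using this

/-! ### Counting strings with prescribed symbols -/

open Classical in
theorem card_filter_agree_on {d n : ℕ} {g : Str d n} {Q : Str d n → Prop} (P : Fin n → Prop)
    [DecidablePred P] (hQ : ∀ f, Q f ↔ ∀ k, P k → g k = f k) :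
    #{f : Str d n | Q f} = d ^ #{k | ¬ P k} := by
  have : ({f : Str d n | Q f} : Finset (Str d n)) =
      Fintype.piFinset fun k => if P k then {g k} else univ := by
    ext f
    simp only [mem_filter, mem_univ, true_and, Fintype.mem_piFinset, hQ]
    refine forall_congr' fun k => ?_
    by_cases hk : P k <;> simp [hk, eq_comm]
  rw [this, Fintype.card_piFinset]
  simp only [apply_ite card, card_singleton, card_univ, Fintype.card_fin]
  rw [prod_ite, prod_const_one, one_mul, prod_const]

open Classical in
theorem card_agree {d n : ℕ} (g : Str d n) (j : ℕ) :
    #{f : Str d n | Agree j g f} = d ^ (n - j) := by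
  refine (card_filter_agree_on (fun k => (k : ℕ) < j) fun _ => Iff.rfl).trans ?_
  congr 1
  have := Fin.card_filter_val_lt (n := n) (m := j)
  have h2 := card_filter_add_card_filter_not (s := (univ : Finset (Fin n))) (fun k => (k : ℕ) < j)
  simp only [card_univ, Fintype.card_fin] at h2
  omega

open Classical in
theorem card_tailAgree_ne {d n : ℕ} (hd : 1 ≤ d) (g : Str d n) {j : ℕ} (hj : 1 ≤ j) (hjn : j ≤ n) :
    (#{f : Str d n | TailAgree j g f ∧ f ≠ g} : ℝ) = (d : ℝ) ^ j - 1 := by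
  have h1 : #{f : Str d n | TailAgree j g f} = d ^ j := by
    refine (card_filter_agree_on (fun k => j ≤ (k : ℕ) + 1 ∧ (k : ℕ) + 1 < n)
      fun _ => Iff.rfl).trans ?_
    congr 1
    -- The free positions are the first `j - 1` and the last one, `j` in total.
    have : ({k : Fin n | ¬ (j ≤ (k : ℕ) + 1 ∧ (k : ℕ) + 1 < n)} : Finset (Fin n)) =
        insert ⟨n - 1, by omega⟩ ({k : Fin n | (k : ℕ) < j - 1} : Finset (Fin n)) := by
      ext k
      simp only [mem_filter, mem_univ, true_and, mem_insert, Fin.ext_iff]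
      omega
    rw [this, card_insert_of_notMem (by simp; omega), Fin.card_filter_val_lt]
    omega
  have h2 : ({f : Str d n | TailAgree j g f ∧ f ≠ g} : Finset (Str d n)) =
      ({f : Str d n | TailAgree j g f} : Finset (Str d n)).erase g := by
    ext f; simp [and_comm]
  rw [h2, card_erase_of_mem (by simp [TailAgree]), h1,
    Nat.cast_sub (Nat.one_le_pow _ _ hd)]
  simp

open Classical in
theorem card_agree_exactly {d n : ℕ} (g : Str d n) {p : ℕ} :
    (#{f : Str d n | Agree p g f ∧ ¬ Agree (p + 1) g f} : ℝ) =
      (d : ℝ) ^ (n - p) - (d : ℝ) ^ (n - (p + 1)) := by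
  have h2 : ({f : Str d n | Agree p g f} : Finset (Str d n)) =
      ({f : Str d n | Agree p g f ∧ ¬ Agree (p + 1) g f} : Finset (Str d n)) ∪
        ({f : Str d n | Agree (p + 1) g f} : Finset (Str d n)) := by
    ext f
    simp only [mem_filter, mem_univ, true_and, mem_union]
    have : Agree (p + 1) g f → Agree p g f := Agree.mono (Nat.le_succ p)
    tauto
  have h3 := card_agree g p
  rw [h2, card_union_of_disjoint, card_agree g (p + 1)] at h3
  · rw [eq_sub_iff_add_eq]
    exact_mod_cast h3
  · rw [Finset.disjoint_left]
    simp only [mem_filter, mem_univ, true_and]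
    tauto

/-- If every value in `F` is attained by `f` on a member of `E` whose key lies in `K`, and `f` is
determined on `E` by the key, then `F` has at most as many elements as `K`. -/
theorem card_le_card_of_key {α ι κ : Type*} {F : Finset ι} {K : Finset κ} {E : Set α} {f : α → ι}
    {key : α → κ} (h : ∀ q ∈ F, ∃ e ∈ E, f e = q ∧ key e ∈ K)
    (hk : ∀ e ∈ E, ∀ e' ∈ E, key e = key e' → f e = f e') : #F ≤ #K := by
  rcases isEmpty_or_nonempty α with _ | _
  · rw [eq_empty_of_forall_notMem fun q hq => isEmptyElim (h q hq).choose]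
    exact Nat.zero_le _
  choose! g hg using h
  refine card_le_card_of_injOn (fun q => key (g q)) (fun q hq => (hg q hq).2.2) ?_
  intro q hq q' hq' e
  rw [← (hg q hq).2.1, ← (hg q' hq').2.1]
  exact hk _ (hg q hq).1 _ (hg q' hq').1 e

/-! ### Invariants of reachable states -/

theorem Reachable.eq_of_output_eq {d n m : ℕ} {alg : RoutingAlgorithm d n m} {S : State d n m}
    (hS : Reachable alg S) :
    ∀ e ∈ S, ∀ e' ∈ S, e.output = e'.output → e = e' := by
  induction hS with
  | idle => simp
  | setup S r φ _ hfree _ _ ih =>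
    rintro e (he | ⟨hi, ho, hp⟩) e' (he' | ⟨hi', ho', hp'⟩) h
    · exact ih e he e' he' h
    · exact absurd (h ▸ ho') (hfree e he).2
    · exact absurd (h ▸ ho) (hfree e' he').2
    · cases e; cases e'; simp_all
  | release S a _ ih => exact fun e he e' he' => ih e he.1 e' he'.1

/-- A request needs a free input, so coexisting branches with a common input stem from one request,
and the algorithm sends those in a common window to one plane. -/
theorem Reachable.plane_eq {d n m t : ℕ} {S : State d n m}
    (hS : Reachable (windowAlgorithm d n m t) S) :
    ∀ e ∈ S, ∀ e' ∈ S, e.input = e'.input → Agree (n - t) e.output e'.output →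
      e.plane = e'.plane := by
  induction hS with
  | idle => simp
  | setup S r φ _ hfree halg _ ih =>
    rintro e (he | ⟨hi, ho, hp⟩) e' (he' | ⟨hi', ho', hp'⟩) h ha
    · exact ih e he e' he' h ha
    · exact absurd (h.trans hi') (hfree e he).1
    · exact absurd (h.symm.trans hi) (hfree e' he').1
    · obtain ⟨p, hp0⟩ := halg (pref (Nat.sub_le n t) e.output)
      rw [hp, hp', hp0 _ ho fun k => rfl, hp0 _ ho' fun k => (ha _ k.2).symm]
  | release S a _ ih => exact fun e he e' he' => ih e he.1 e' he'.1

/-! ### Blockers and the planes they occupy -/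

/-- The established branches sharing an internal link with a branch of the request `r` to an
output in the window (of size `d ^ t`) of `b`. -/
def blockers {d n m : ℕ} (S : State d n m) (r : Request d n) (t : ℕ) (b : Str d n) :
    State d n m :=
  {e ∈ S | ∃ y ∈ r.outputs, Agree (n - t) b y ∧ ShareLink r.input y e.input e.output}

open Classical in
/-- The planes of the branches in `E`. -/
noncomputable def planes {d n m : ℕ} (E : State d n m) : Finset (Fin m) :=
  {q | ∃ e ∈ E, e.plane = q}

theorem mem_planes {d n m : ℕ} {E : State d n m} {q : Fin m} :
    q ∈ planes E ↔ ∃ e ∈ E, e.plane = q := by simp [planes]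

/-- The blockers whose output has precisely the first `p` symbols in common with `b`. -/
def blockersAt {d n m : ℕ} (S : State d n m) (r : Request d n) (t : ℕ) (b : Str d n) (p : ℕ) :
    State d n m :=
  {e ∈ blockers S r t b | Agree p b e.output ∧ ¬ Agree (p + 1) b e.output}

/-- The blockers whose output lies in the window of `b`. -/
def blockersIn {d n m : ℕ} (S : State d n m) (r : Request d n) (t : ℕ) (b : Str d n) :
    State d n m :=
  {e ∈ blockers S r t b | Agree (n - t) b e.output}

open Classical in
theorem planes_blockers_subset {d n m : ℕ} (S : State d n m) (r : Request d n) (t : ℕ)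
    (b : Str d n) :
    planes (blockers S r t b) ⊆
      (Ico 1 (n - t)).biUnion (fun p => planes (blockersAt S r t b p)) ∪
        planes (blockersIn S r t b) := by
  intro q hq
  obtain ⟨e, he, rfl⟩ := mem_planes.1 hq
  rw [mem_union, mem_biUnion]
  by_cases hW : Agree (n - t) b e.output
  · exact .inr (mem_planes.2 ⟨e, ⟨he, hW⟩, rfl⟩)
  · left
    have hex : ∃ p, ¬ Agree (p + 1) b e.output := by
      refine ⟨n - t, fun h => hW (h.mono (Nat.le_succ _))⟩
    have h1 := Nat.find_spec hex
    have h2 : Agree (Nat.find hex) b e.output := by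
      rcases Nat.eq_zero_or_pos (Nat.find hex) with h0 | h0
      · rw [h0]; intro k hk; omega
      · have := Nat.find_min hex (Nat.sub_lt h0 one_pos)
        rwa [not_not, show Nat.find hex - 1 + 1 = Nat.find hex by omega] at this
    refine ⟨Nat.find hex, mem_Ico.2 ⟨?_, ?_⟩, mem_planes.2 ⟨e, ⟨he, h2, h1⟩, rfl⟩⟩
    -- `p = 0` is impossible: a shared link forces agreement in the first output symbol, which `y`
    -- has in common with `b`.
    · obtain ⟨-, y, -, hy, hsh⟩ := he
      obtain ⟨j, hj1, -, hj, -⟩ := hsh.exists_agree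
      by_contra! h
      obtain h0 : Nat.find hex = 0 := by omega
      rw [h0] at h1
      refine h1 fun k hk => ?_
      have hnt : 0 < n - t := by
        by_contra! h
        exact hW fun k hk => by omega
      exact (hy k (by omega)).trans (hj k (by omega))
    · by_contra! h
      exact hW (h2.mono h)

section Counting

variable {d n m t : ℕ} {S : State d n m} {r : Request d n}

open Classical in
theorem card_planes_blockersAt_le_outputs (hS : Reachable (windowAlgorithm d n m t) S)
    (b : Str d n) (p : ℕ) :
    (#(planes (blockersAt S r t b p)) : ℝ) ≤ (d : ℝ) ^ (n - p) - (d : ℝ) ^ (n - (p + 1)) := by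
  rw [← card_agree_exactly b, Nat.cast_le]
  refine card_le_card_of_key (E := blockersAt S r t b p) (f := Branch.plane)
    (key := Branch.output) (fun q hq => ?_)
    (fun e he e' he' h => by rw [hS.eq_of_output_eq e he.1.1 e' he'.1.1 h])
  obtain ⟨e, he, rfl⟩ := mem_planes.1 hq
  exact ⟨e, he, rfl, by simpa using he.2⟩

open Classical in
-- A blocker's plane is determined by its input and the window of its output. The requested `y`
-- agrees with `b` beyond position `p`, so the blocker leaves `y` after `p` symbols too; hence `j ≤
-- p` and its input is one of `d^p - 1`.
theorem card_planes_blockersAt_le_inputs (hd : 1 ≤ d)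
    (hS : Reachable (windowAlgorithm d n m t) S) (hr : r.IsFree S)
    (b : Str d n) {p : ℕ} (hp : 1 ≤ p) (hpn : p < n - t) :
    (#(planes (blockersAt S r t b p)) : ℝ) ≤
      ((d : ℝ) ^ p - 1) * ((d : ℝ) ^ (n - t - p) - (d : ℝ) ^ (n - t - (p + 1))) := by
  have hnt : n - t ≤ n := Nat.sub_le n t
  rw [← card_tailAgree_ne hd r.input hp (by omega), ← card_agree_exactly (pref hnt b),
    ← Nat.cast_mul, ← card_product, Nat.cast_le]
  refine card_le_card_of_key (E := blockersAt S r t b p) (f := Branch.plane)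
    (key := fun e => (e.input, pref hnt e.output)) (fun q hq => ?_)
    (fun e he e' he' h => by
      obtain ⟨h1, h2⟩ := Prod.ext_iff.1 h
      exact hS.plane_eq e he.1.1 e' he'.1.1 h1 ((pref_eq_iff hnt _ _).1 h2))
  obtain ⟨e, he, rfl⟩ := mem_planes.1 hq
  refine ⟨e, he, rfl, ?_⟩
  obtain ⟨⟨heS, y, -, hy, hsh⟩, h1, h2⟩ := he
  obtain ⟨j, hj1, -, hj, hj'⟩ := hsh.exists_agree
  simp only [mem_product, mem_filter, mem_univ, true_and]
  refine ⟨⟨hj'.mono ?_, (hr e heS).1⟩, fun k hk => h1 _ hk, fun h => h2 fun k hk => ?_⟩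
  · by_contra! h
    exact h2 ((hy.mono hpn).trans (hj.mono h))
  · exact h ⟨k, by omega⟩ hk

open Classical in
theorem card_planes_blockersIn_add_le (hS : Reachable (windowAlgorithm d n m t) S)
    (hr : r.IsFree S) (ht : t ≤ n) (b : Str d n) :
    #(planes (blockersIn S r t b)) + #{y ∈ r.outputs | Agree (n - t) b y} ≤ d ^ t := by
  have h : #(planes (blockersIn S r t b)) ≤
      #(({y : Str d n | Agree (n - t) b y} : Finset (Str d n)) \
        {y ∈ r.outputs | Agree (n - t) b y}) := by
    refine card_le_card_of_key (E := blockersIn S r t b) (f := Branch.plane)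
      (key := Branch.output) (fun q hq => ?_)
      (fun e he e' he' h => by rw [hS.eq_of_output_eq e he.1.1 e' he'.1.1 h])
    obtain ⟨e, he, rfl⟩ := mem_planes.1 hq
    refine ⟨e, he, rfl, ?_⟩
    have := (hr e he.1.1).2
    simp [he.2, this]
  have h2 := card_sdiff_add_card_eq_card
    (s := ({y ∈ r.outputs | Agree (n - t) b y} : Finset (Str d n)))
    (t := ({y : Str d n | Agree (n - t) b y} : Finset (Str d n)))
    (fun y hy => by simpa using (mem_filter.1 hy).2)
  rw [card_agree, Nat.sub_sub_self ht] at h2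
  omega

theorem card_planes_blockersIn_le (hS : Reachable (windowAlgorithm d n m t) S)
    (hr : r.IsFree S) (ht : t ≤ n) {b : Str d n} (hb : b ∈ r.outputs) :
    (#(planes (blockersIn S r t b)) : ℝ) ≤ (d : ℝ) ^ t - 1 := by
  classical
  have h := card_planes_blockersIn_add_le hS hr ht b
  have h1 : 0 < #{y ∈ r.outputs | Agree (n - t) b y} :=
    card_pos.2 ⟨b, mem_filter.2 ⟨hb, fun _ _ => rfl⟩⟩
  have : #(planes (blockersIn S r t b)) + 1 ≤ d ^ t := by omega
  rw [le_sub_iff_add_le]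
  exact_mod_cast this

open Classical in
/-- Blockers in the window of `b` are either branches of one of the few inputs having many
symbols in common with the requesting input, or their output has its first `t` symbols in common
with a requested output. -/
theorem card_planes_blockersIn_le_prefixes (hd : 1 ≤ d)
    (hS : Reachable (windowAlgorithm d n m t) S) (hr : r.IsFree S) (ht : t ≤ n) (ht' : 1 ≤ t)
    (b : Str d n) :
    (#(planes (blockersIn S r t b)) : ℝ) ≤ (d : ℝ) ^ (t - 1) - 1 +
      #(image (pref ht) {y ∈ r.outputs | Agree (n - t) b y}) * ((d : ℝ) ^ (n - t) - 1) := by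
  set B : Finset (Str d n) := {y ∈ r.outputs | Agree (n - t) b y} with hB
  set C := image (pref ht) B with hC
  -- For `t = 1` no `j ≥ 1` satisfies `j ≤ t - 1`; the condition `2 ≤ t` makes this class empty,
  -- matching `d^0 - 1 = 0`.
  set E₁ : State d n m := {e ∈ blockersIn S r t b | 2 ≤ t ∧ TailAgree (t - 1) r.input e.input}
    with hE₁
  set E₂ : State d n m := {e ∈ blockersIn S r t b | pref ht e.output ∈ C} with hE₂
  have hsub : planes (blockersIn S r t b) ⊆ planes E₁ ∪ planes E₂ := by
    intro q hq
    obtain ⟨e, he, rfl⟩ := mem_planes.1 hq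
    obtain ⟨y, hy, hby, hsh⟩ := he.1.2
    obtain ⟨j, hj1, -, hj, hj'⟩ := hsh.exists_agree
    rw [mem_union, mem_planes, mem_planes]
    rcases le_or_gt j (t - 1) with h | h
    · exact .inl ⟨e, ⟨he, by omega, hj'.mono h⟩, rfl⟩
    · refine .inr ⟨e, ⟨he, mem_image.2 ⟨y, mem_filter.2 ⟨hy, hby⟩, ?_⟩⟩, rfl⟩
      rw [pref_eq_iff]
      exact hj.mono (by omega)
  have h1 : (#(planes E₁) : ℝ) ≤ (d : ℝ) ^ (t - 1) - 1 := by
    rcases Nat.lt_or_ge t 2 with h | h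
    · have h0 : planes E₁ = ∅ := by
        refine eq_empty_of_forall_notMem fun q hq => ?_
        obtain ⟨e, he, rfl⟩ := mem_planes.1 hq
        exact absurd he.2.1 (by omega)
      obtain rfl : t = 1 := by omega
      simp [h0]
    · rw [← card_tailAgree_ne hd r.input (by omega : 1 ≤ t - 1) (by omega), Nat.cast_le]
      refine card_le_card_of_key (E := E₁) (f := Branch.plane)
        (key := Branch.input) (fun q hq => ?_)
        (fun e he e' he' h => hS.plane_eq e he.1.1.1 e' he'.1.1.1 h (he.1.2.symm.trans he'.1.2))
      obtain ⟨e, he, rfl⟩ := mem_planes.1 hq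
      exact ⟨e, he, rfl, by simpa using ⟨he.2.2, (hr e he.1.1.1).1⟩⟩
  have h2 : #(planes E₂) + #B ≤ #C * d ^ (n - t) := by
    have h3 : #(planes E₂) ≤ #(({y : Str d n | pref ht y ∈ C} : Finset (Str d n)) \ B) := by
      refine card_le_card_of_key (E := E₂) (f := Branch.plane)
        (key := Branch.output) (fun q hq => ?_)
        (fun e he e' he' h => by rw [hS.eq_of_output_eq e he.1.1.1 e' he'.1.1.1 h])
      obtain ⟨e, he, rfl⟩ := mem_planes.1 hq
      refine ⟨e, he, rfl, ?_⟩
      have := (hr e he.1.1.1).2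
      rw [mem_sdiff, hB, mem_filter, mem_filter]
      exact ⟨⟨mem_univ _, he.2⟩, fun h => this h.1⟩
    have h4 := card_sdiff_add_card_eq_card (s := B)
      (t := ({y : Str d n | pref ht y ∈ C} : Finset (Str d n)))
      (fun y hy => mem_filter.2 ⟨mem_univ _, mem_image_of_mem (pref ht) hy⟩)
    have h5 : #({y : Str d n | pref ht y ∈ C} : Finset (Str d n)) ≤ #C * d ^ (n - t) := by
      rw [mul_comm]
      refine card_le_mul_card_image_of_maps_to (f := pref ht) (fun y hy => by simpa using hy) _ ?_
      intro c hc
      obtain ⟨y, -, rfl⟩ := mem_image.1 hc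
      rw [← card_agree y t]
      refine card_le_card fun v hv => ?_
      simp only [mem_filter, mem_univ, true_and] at hv ⊢
      exact ((pref_eq_iff ht _ _).1 hv.2).symm
    omega
  have hCB : #C ≤ #B := card_image_le
  have h3 : (#(planes E₂) : ℝ) ≤ #C * ((d : ℝ) ^ (n - t) - 1) := by
    have : (#(planes E₂) : ℝ) + #C ≤ #C * (d : ℝ) ^ (n - t) := by
      exact_mod_cast (Nat.add_le_add_left hCB _).trans h2
    linarith
  have h4 : (#(planes (blockersIn S r t b)) : ℝ) ≤ #(planes E₁) + #(planes E₂) := by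
    exact_mod_cast (card_le_card hsub).trans (card_union_le _ _)
  linarith

/-- The sharper bound on the planes blocked from inside a large window. -/
theorem card_planes_blockersIn_le_of_large (hd : 1 ≤ d)
    (hS : Reachable (windowAlgorithm d n m t) S) (hr : r.IsFree S) (ht : t ≤ n)
    (hnt : n + 1 ≤ 2 * t) (b : Str d n) :
    (#(planes (blockersIn S r t b)) : ℝ) ≤
      (d : ℝ) ^ t - (d : ℝ) ^ (2 * t - n - 1) * ((d : ℝ) - 1) - 1 := by
  classical
  have h1 := card_planes_blockersIn_add_le hS hr ht b
  have h2 := card_planes_blockersIn_le_prefixes hd hS hr ht (by omega) b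
  have hCB := card_image_le (s := {y ∈ r.outputs | Agree (n - t) b y}) (f := pref ht)
  set c := #(image (pref ht) {y ∈ r.outputs | Agree (n - t) b y})
  have h3 : (#(planes (blockersIn S r t b)) : ℝ) + c ≤ (d : ℝ) ^ t := by
    exact_mod_cast (Nat.add_le_add_left hCB _).trans h1
  have hD : (1 : ℝ) ≤ d := by exact_mod_cast hd
  have hpow : (1 : ℝ) ≤ (d : ℝ) ^ (n - t) := one_le_pow₀ hD
  -- With `k = d^(2t-n-1)(d-1)` one has `k d^(n-t) = d^t - d^(t-1)`, so `d^t - c` for `c ≥ k + 1`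
  -- and the prefix bound for `c ≤ k` give the same estimate `d^t - k - 1`.
  rcases Nat.lt_or_ge (d ^ (2 * t - n - 1) * (d - 1)) c with h | h
  · have : ((d : ℝ) ^ (2 * t - n - 1) * ((d : ℝ) - 1)) + 1 ≤ c := by
      have := Nat.succ_le_of_lt h
      rw [← Nat.cast_le (α := ℝ)] at this
      push_cast [hd] at this
      exact this
    linarith
  · have h' : (c : ℝ) ≤ (d : ℝ) ^ (2 * t - n - 1) * ((d : ℝ) - 1) := by
      replace h := (Nat.cast_le (α := ℝ)).2 h
      push_cast [hd] at h
      exact h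
    have h4 := mul_le_mul_of_nonneg_right h' (sub_nonneg.2 hpow)
    have e1 : (d : ℝ) ^ (2 * t - n - 1) * (d : ℝ) ^ (n - t) = (d : ℝ) ^ (t - 1) := by
      rw [← pow_add]; congr 1; omega
    have e2 : (d : ℝ) ^ t = (d : ℝ) ^ (t - 1) * d := by
      rw [← pow_succ]; congr 1; omega
    linear_combination h2 + h4 + ((d : ℝ) - 1) * e1 - e2

theorem card_planes_blockers_le (S : State d n m) (r : Request d n) (t : ℕ) (b : Str d n) :
    (#(planes (blockers S r t b)) : ℝ) ≤
      ∑ p ∈ Ico 1 (n - t), (#(planes (blockersAt S r t b p)) : ℝ) +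
        #(planes (blockersIn S r t b)) := by
  classical
  exact_mod_cast (card_le_card (planes_blockers_subset S r t b)).trans
    ((card_union_le _ _).trans (Nat.add_le_add_right card_biUnion_le _))

end Counting

/-! ### Summation and the two ranges of `t` -/

theorem sum_Ico_pow_sub_sub_pow (x : ℝ) (N : ℕ) {a b : ℕ} (hab : a ≤ b) :
    ∑ p ∈ Ico a b, (x ^ (N - p) - x ^ (N - (p + 1))) = x ^ (N - a) - x ^ (N - b) := by
  have := sum_Ico_sub (fun p => -x ^ (N - p)) hab
  simpa [sub_eq_add_neg, add_comm] using this

theorem sum_Ico_pow_sub_one_mul (x : ℝ) {N b : ℕ} (hb : 1 ≤ b) (hbN : b ≤ N) :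
    ∑ p ∈ Ico 1 b, (x ^ p - 1) * (x ^ (N - p) - x ^ (N - (p + 1))) =
      ((b : ℝ) - 1) * (x ^ N - x ^ (N - 1)) - (x ^ (N - 1) - x ^ (N - b)) := by
  rw [← sum_Ico_pow_sub_sub_pow x N hb]
  have : ∀ p ∈ Ico 1 b, (x ^ p - 1) * (x ^ (N - p) - x ^ (N - (p + 1))) =
      (x ^ N - x ^ (N - 1)) - (x ^ (N - p) - x ^ (N - (p + 1))) := by
    intro p hp
    have hp := mem_Ico.1 hp
    have e1 : x ^ p * x ^ (N - p) = x ^ N := by rw [← pow_add]; congr 1; omega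
    have e2 : x ^ p * x ^ (N - (p + 1)) = x ^ (N - 1) := by rw [← pow_add]; congr 1; omega
    linear_combination e1 - e2
  rw [sum_congr rfl this, sum_sub_distrib, sum_const, Nat.card_Ico, nsmul_eq_mul,
    Nat.cast_sub hb, Nat.cast_one]

/-- `blockers` ranges over all requested outputs in the window of `b`, so one plane avoiding it
carries the whole subrequest. -/
theorem isWideSenseNonblocking_of_card_lt {d n m t : ℕ}
    (h : ∀ S : State d n m, Reachable (windowAlgorithm d n m t) S → ∀ r : Request d n,
      r.IsFree S → ∀ b ∈ r.outputs, #(planes (blockers S r t b)) < m) :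
    IsWideSenseNonblocking (windowAlgorithm d n m t) := by
  intro S hS r hr
  have hplane : ∀ b ∈ r.outputs, ∃ q : Fin m, q ∉ planes (blockers S r t b) := by
    intro b hb
    by_contra! hq
    have := h S hS r hr b hb
    rw [eq_univ_of_forall hq] at this
    simp at this
  have hw : ∀ w : Str d (n - t), ∃ q : Fin m, ∀ b ∈ r.outputs, b ∈ window t w →
      ∀ e ∈ S, e.plane = q → ¬ ShareLink r.input b e.input e.output := by
    intro w
    by_cases hex : ∃ b₀ ∈ r.outputs, b₀ ∈ window t w
    · obtain ⟨b₀, hb₀, hw₀⟩ := hex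
      obtain ⟨q, hq⟩ := hplane b₀ hb₀
      refine ⟨q, fun b hb hbw e he heq hsh => hq (mem_planes.2 ⟨e, ⟨he, b, hb, ?_, hsh⟩, heq⟩)⟩
      exact fun k hk => (hw₀ ⟨k, hk⟩).trans (hbw ⟨k, hk⟩).symm
    -- No output of this window is requested, so any plane will do; a requested output elsewhere
    -- shows that a plane exists.
    · obtain ⟨b, hb⟩ := r.outputs_nonempty
      obtain ⟨q, -⟩ := hplane b hb
      exact ⟨q, fun b hb hbw => absurd ⟨b, hb, hbw⟩ hex⟩
  choose q hq using hw
  refine ⟨fun b => q (pref (Nat.sub_le n t) b), fun w => ⟨q w, fun b hb hbw => ?_⟩,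
    fun b hb e he h => hq _ b hb (fun k => rfl) e he h⟩
  exact congrArg q (funext hbw)

theorem isWideSenseNonblocking_of_small {d n m t : ℕ} (hd : 1 ≤ d) (hnt : 2 * t + 2 ≤ n)
    (hm : (d : ℝ) ^ (n - 2 * t - 1) + t * (d : ℝ) ^ (n - t - 1) * ((d : ℝ) - 1) ≤ m) :
    IsWideSenseNonblocking (windowAlgorithm d n m t) := by
  refine isWideSenseNonblocking_of_card_lt fun S hS r hr b hb => ?_
  have h1 := card_planes_blockers_le S r t b
  have h2 := card_planes_blockersIn_le hS hr (by omega) hb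
  -- The input bound is `d^p - 1` and the output bound `d^t` times the same number of windows, so
  -- the switch comes after `p = t`.
  rw [← sum_Ico_consecutive _ (by omega : 1 ≤ t + 1) (by omega : t + 1 ≤ n - t)] at h1
  have h3 := sum_le_sum fun p (hp : p ∈ Ico 1 (t + 1)) =>
    card_planes_blockersAt_le_inputs hd hS hr b (mem_Ico.1 hp).1
      ((mem_Ico.1 hp).2.trans_le (by omega : t + 1 ≤ n - t))
  have h4 := sum_le_sum fun p (_ : p ∈ Ico (t + 1) (n - t)) =>
    card_planes_blockersAt_le_outputs (r := r) hS b p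
  rw [sum_Ico_pow_sub_one_mul _ (by omega) (by omega)] at h3
  rw [sum_Ico_pow_sub_sub_pow _ _ (by omega)] at h4
  rw [show n - t - (t + 1) = n - 2 * t - 1 by omega] at h3
  rw [show n - (t + 1) = n - t - 1 by omega, show n - (n - t) = t by omega] at h4
  have e : (d : ℝ) ^ (n - t) = (d : ℝ) ^ (n - t - 1) * d := by
    rw [← pow_succ]; congr 1; omega
  rw [e] at h3
  push_cast at h3
  rw [← Nat.cast_lt (α := ℝ)]
  linarith

theorem sum_card_planes_blockersAt_le {d n m t : ℕ} (hd : 1 ≤ d) (ht : t < n) {S : State d n m}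
    {r : Request d n} (hS : Reachable (windowAlgorithm d n m t) S) (hr : r.IsFree S)
    (b : Str d n) :
    ∑ p ∈ Ico 1 (n - t), (#(planes (blockersAt S r t b p)) : ℝ) ≤
      (d : ℝ) ^ (n - t - 1) * (((d : ℝ) - 1) * ((n : ℝ) - t - 1) - 1) + 1 := by
  have h3 := sum_le_sum fun p (hp : p ∈ Ico 1 (n - t)) =>
    card_planes_blockersAt_le_inputs hd hS hr b (mem_Ico.1 hp).1 (mem_Ico.1 hp).2
  rw [sum_Ico_pow_sub_one_mul _ (by omega) le_rfl, Nat.sub_self, pow_zero,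
    Nat.cast_sub ht.le] at h3
  have e : (d : ℝ) ^ (n - t) = (d : ℝ) ^ (n - t - 1) * d := by
    rw [← pow_succ]; congr 1; omega
  rw [e] at h3
  linarith

theorem isWideSenseNonblocking_of_large {d n m t : ℕ} (hd : 2 ≤ d) (hn : 1 ≤ n) (ht : t ≤ n)
    (hm : (d : ℝ) ^ ((n : ℤ) - t - 1) * (((d : ℝ) - 1) * ((n : ℝ) - t - 1) - 1)
        + (d : ℝ) ^ t - (d : ℝ) ^ (2 * (t : ℤ) - n - 1) * ((d : ℝ) - 1) + 1 ≤ m) :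
    IsWideSenseNonblocking (windowAlgorithm d n m t) := by
  have hd1 : 1 ≤ d := by omega
  have hD : (2 : ℝ) ≤ d := by exact_mod_cast hd
  refine isWideSenseNonblocking_of_card_lt fun S hS r hr b hb => ?_
  have h1 := card_planes_blockers_le S r t b
  have hout : ∑ p ∈ Ico 1 (n - t), (#(planes (blockersAt S r t b p)) : ℝ) ≤
      (d : ℝ) ^ ((n : ℤ) - t - 1) * (((d : ℝ) - 1) * ((n : ℝ) - t - 1) - 1) + 1 := by
    rcases ht.lt_or_eq with h | rfl
    · rw [show (n : ℤ) - t - 1 = ((n - t - 1 : ℕ) : ℤ) by omega, zpow_natCast]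
      exact sum_card_planes_blockersAt_le hd1 h hS hr b
    -- For `t = n` the sum is empty and the right side is `d⁻¹ * (-d) + 1 = 0`.
    · have : (d : ℝ) ≠ 0 := by positivity
      simp [field]
  rcases Nat.lt_or_ge n (2 * t) with h | h
  · have h2 := card_planes_blockersIn_le_of_large hd1 hS hr ht h b
    rw [show 2 * (t : ℤ) - n - 1 = ((2 * t - n - 1 : ℕ) : ℤ) by omega, zpow_natCast] at hm
    rw [← Nat.cast_lt (α := ℝ)]
    linarith
  · have h2 := card_planes_blockersIn_le hS hr ht hb
    -- For `2t ≤ n` the subtracted term is below `1`, so the plain window bound `d^t - 1` suffices.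
    have h3 : (d : ℝ) ^ (2 * (t : ℤ) - n - 1) * ((d : ℝ) - 1) < 1 := by
      have h4 : (d : ℝ) ^ (2 * (t : ℤ) - n - 1) ≤ (d : ℝ) ^ (-1 : ℤ) :=
        zpow_le_zpow_right₀ (by linarith) (by omega)
      calc _ ≤ (d : ℝ) ^ (-1 : ℤ) * ((d : ℝ) - 1) :=
            mul_le_mul_of_nonneg_right h4 (by linarith)
        _ < 1 := by
            rw [zpow_neg_one, inv_mul_lt_iff₀ (by linarith)]
            linarith
    have htn : t < n := by omega
    rw [show (n : ℤ) - t - 1 = ((n - t - 1 : ℕ) : ℤ) by omega, zpow_natCast] at hm hout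
    have hlt : (d : ℝ) ^ (n - t - 1) * (((d : ℝ) - 1) * ((n : ℝ) - t - 1) - 1) + (d : ℝ) ^ t <
        m := by linarith
    have hle : (d : ℝ) ^ (n - t - 1) * (((d : ℝ) - 1) * ((n : ℝ) - t - 1) - 1) + (d : ℝ) ^ t + 1 ≤
        m := by
      have hint : (d : ℝ) ^ (n - t - 1) * (((d : ℝ) - 1) * ((n : ℝ) - t - 1) - 1) + (d : ℝ) ^ t =
          (((d : ℤ) ^ (n - t - 1) * (((d : ℤ) - 1) * ((n : ℤ) - t - 1) - 1) + (d : ℤ) ^ t : ℤ) :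
            ℝ) := by push_cast; rfl
      rw [hint] at hlt ⊢
      exact_mod_cast hlt
    rw [← Nat.cast_lt (α := ℝ)]
    linarith

end Multilog

theorem mainTheorem9 (d n m t : ℕ) (hd : 2 ≤ d) (hn : 1 ≤ n) (ht : t ≤ n) :
    ((t : ℤ) ≤ (n / 2 : ℕ) - 1 →
      (d : ℝ) ^ ((n : ℤ) - 2 * t - 1) + t * (d : ℝ) ^ ((n : ℤ) - t - 1) * ((d : ℝ) - 1) ≤ m →
      Multilog.IsWideSenseNonblocking (Multilog.windowAlgorithm d n m t)) ∧
    (n / 2 ≤ t →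
      (d : ℝ) ^ ((n : ℤ) - t - 1) * (((d : ℝ) - 1) * ((n : ℝ) - t - 1) - 1)
        + (d : ℝ) ^ t - (d : ℝ) ^ (2 * (t : ℤ) - n - 1) * ((d : ℝ) - 1) + 1 ≤ m →
      Multilog.IsWideSenseNonblocking (Multilog.windowAlgorithm d n m t)) := by
  refine ⟨fun h hm => ?_, fun _ hm => Multilog.isWideSenseNonblocking_of_large hd hn ht hm⟩
  refine Multilog.isWideSenseNonblocking_of_small (by omega) (by omega) ?_
  rw [show (n : ℤ) - 2 * t - 1 = ((n - 2 * t - 1 : ℕ) : ℤ) by omega,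
    show (n : ℤ) - t - 1 = ((n - t - 1 : ℕ) : ℤ) by omega, zpow_natCast, zpow_natCast] at hm
  exact hm
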